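/- Theorem (Schnorr--Stimm theorem for probabilistic finite automata). Let $A$ be a finite alphabet, let $\mu: A\to(0,1]$ satisfy $\sum_{a\in A}\mu(a)=1$ (a positive Bernoulli measure), write $\mu(a_1\cdots a_k)=\prod_{j}\mu(a_j)$ for words, and let $X=X(0)X(1)\cdots\in A^\omega$. Call $X$ $\mu$-normal if for every finite word $w$ over $A$ the frequency of (possibly overlapping) occurrences of $w$ in $X(0)\cdots X(n)$ tends to $\mu(w)$ as $n\to\infty$. A probabilistic $\mu$-gambler is a tuple $\mathcal G=(Q,A,q_I,\delta,\gamma)$ where $Q$ is a finite set of states, $q_I\in Q$ is the initial state, $\delta$ assigns to each $(q,a)\in Q\times A$ a probability distribution $\delta(q,a)$ on $Q$ (with arbitrary real probabilities), and $\gamma: Q\times A\to[0,\infty)$ satisfies $\sum_{a\in A}\mu(a)\gamma(q,a)=1$ for every $q\in Q$. Let $(\delta_n(q,a))_{n\in\mathbb N,\,q\in Q,\,a\in A}$ be independent random variables, $\delta_n(q,a)$ having distribution $\delta(q,a)$. The run of $\mathcal G$ on $X$ and its capital are the random sequences given by $q_0=q_I$, $q_{n+1}=\delta_{n+1}(q_n,X(n))$,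 and $C_0=1$, $C_{n+1}=C_n\cdot\gamma(q_n,X(n))$. The gambler wins against $X$ if $\limsup_{n\to\infty} C_n=+\infty$, and loses otherwise (that is, if $(C_n)_n$ is bounded). Then the following are equivalent: (i) $X$ is $\mu$-normal; (ii) every probabilistic $\mu$-gambler betting on $X$ loses almost surely. -/

import Mathlib

open Filter Topology MeasureTheory

noncomputable section

namespace PFA

/-! ### Words, frequencies, normality -/

/-- The finite word `X[0..n] = X(0) X(1) ... X(n)`, of length `n + 1`. -/
def initialWord {A : Type*} (X : ℕ → A) (n : ℕ) : List A :=
  (List.range (n + 1)).map X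

/-- The number of (possibly overlapping) occurrences of the word `u` in the word `w`: the number
of positions `i` with `i + |u| ≤ |w|` at which the factor of `w` of length `|u|` is `u`. -/
def nbocc {A : Type*} [DecidableEq A] (u w : List A) : ℕ :=
  ((Finset.range (w.length + 1)).filter
    (fun i => i + u.length ≤ w.length ∧ (w.drop i).take u.length = u)).card

/-- The frequency of `u` in `w`, meaningful when `|u| ≤ |w|`. -/
def freq {A : Type*} [DecidableEq A] (u w : List A) : ℝ :=
  (nbocc u w : ℝ) / ((w.length : ℝ) - (u.length : ℝ) + 1)

/-- The Bernoulli probability of a finite word. -/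
def wordProb {A : Type*} (μ : A → ℝ) (w : List A) : ℝ :=
  (w.map μ).prod

/-- `X` is `μ`-normal: every finite word has asymptotic frequency `μ(w)` in `X`. -/
def IsNormal {A : Type*} [DecidableEq A] (μ : A → ℝ) (X : ℕ → A) : Prop :=
  ∀ w : List A, Tendsto (fun n => freq w (initialWord X n)) atTop (𝓝 (wordProb μ w))

/-! ### Probabilistic automata and gamblers -/

/-- A probabilistic finite automaton with states `Q` over the alphabet `A` (runs are infinite, so
there are no final states). Finiteness of `Q` and `A` is imposed where automata are used. -/
structure ProbAutomaton (Q A : Type*) where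
  start : Q
  trans : Q → A → PMF Q

/-- A probabilistic `μ`-gambler: a probabilistic automaton together with nonnegative betting
multipliers, which are fair with respect to `μ` in every state. -/
structure ProbGambler {A : Type*} [Fintype A] (μ : A → ℝ) (Q : Type*)
    extends ProbAutomaton Q A where
  bet : Q → A → ℝ
  bet_nonneg : ∀ q a, 0 ≤ bet q a
  fair : ∀ q, ∑ a, μ a * bet q a = 1

/-- The state reached after reading the first `n` letters of `X`, when `t (k, r, a)` is the outcome
of the random transition `δ_k(r, a)`; the letter read after a word `w` uses `δ_{|w|+1}`. -/
def ProbAutomaton.state {Q A : Type*} (M : ProbAutomaton Q A) (X : ℕ → A)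
    (t : ℕ × Q × A → Q) : ℕ → Q
  | 0 => M.start
  | n + 1 => t (n + 1, M.state X t n, X n)

/-- The law of the family `(δ_k(r, a))` of independent random transitions, where `δ_k(r, a)` has
distribution `δ(r, a)`: the product probability measure on the space of outcomes. -/
def ProbAutomaton.transitionLaw {Q A : Type*} [MeasurableSpace Q] (M : ProbAutomaton Q A) :
    Measure (ℕ × Q × A → Q) :=
  Measure.infinitePi (fun i : ℕ × Q × A => (M.trans i.2.1 i.2.2).toMeasure)

namespace ProbGambler

variable {A : Type*} [Fintype A] {μ : A → ℝ} {Q : Type*}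

/-- The capital after reading the first `n` letters of `X`, for the outcome `t` of the random
transitions. -/
def capital (G : ProbGambler μ Q) (X : ℕ → A) (t : ℕ × Q × A → Q) : ℕ → ℝ
  | 0 => 1
  | n + 1 => G.capital X t n * G.bet (G.toProbAutomaton.state X t n) (X n)

/-- For the outcome `t` of the random transitions, the gambler wins against `X`. -/
def Wins (G : ProbGambler μ Q) (X : ℕ → A) (t : ℕ × Q × A → Q) : Prop :=
  limsup (fun n => ((G.capital X t n : ℝ) : EReal)) atTop = ⊤

/-- The gambler loses (does not win) against `X` almost surely. The finite state set carries its
discrete σ-algebra. -/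
def LosesAlmostSurely (G : ProbGambler μ Q) (X : ℕ → A) : Prop :=
  letI : MeasurableSpace Q := ⊤
  ∀ᵐ t ∂G.toProbAutomaton.transitionLaw, ¬ G.Wins X t

end ProbGambler

end PFA

end

/-! From normality to losing, the proof follows the mean square root of the capital. Since √x ≤ (1 +
x)/2 with equality only at x = 1, a fair bet on a `μ`-random letter never raises this mean, and
lowers it unless every multiplier of the state is 1. The states from which it stays 1 forever
(`idle`) are closed under transitions, and no bet is made in them. On the other states some power of
the mean weight matrix has all row sums below 1, and a further power has entry total below 1.
Normality stands in for the random letters: averages of matrix products over the windows of `X`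
converge to powers of the mean matrix (`IsNormal.tendsto_average_wordMatrix`), so the mean square
root carried by non-idle states is summable in time (`IsNormal.summable_vecMul`). By Tonelli the
random sum is almost surely finite: a run either enters an idle state, where its capital freezes, or
has capital tending to 0.

Conversely, a deterministic gambler remembering the last |u| letters can multiply its capital by 1 +
ε dᵢ, where dᵢ is the indicator of `ub` at i minus μ(b) times that of `u`. If it loses for all small
ε of either sign, the averages of dᵢ tend to 0 (`tendsto_average_zero_of_prod_bounded`). Thus the
frequency of `ub` is μ(b) times that of `u`, and normality follows by induction on the word. -/

noncomputable section

namespace PFA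

open ProbabilityTheory
open scoped ENNReal

/-! ### Factors of a sequence and normality -/

/-- The factor `X(i) ⋯ X(i + k - 1)` of `X`. -/
def factor {A : Type*} (X : ℕ → A) (i k : ℕ) : List A :=
  (List.range k).map fun j => X (i + j)

section Words

variable {A : Type*} (X : ℕ → A)

@[simp] lemma length_factor (i k : ℕ) : (factor X i k).length = k := by simp [factor]

@[simp] lemma factor_zero (i : ℕ) : factor X i 0 = [] := by simp [factor]

lemma factor_succ (i k : ℕ) : factor X i (k + 1) = factor X i k ++ [X (i + k)] := by
  simp [factor, List.range_succ]

lemma factor_succ' (i k : ℕ) : factor X i (k + 1) = X i :: factor X (i + 1) k := by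
  simp only [factor, List.range_succ_eq_map, List.map_cons, List.map_map, add_zero]
  congr 2
  funext j
  simp only [Function.comp, Nat.succ_eq_add_one]
  congr 1
  omega

lemma take_drop_initialWord {i k n : ℕ} (h : i + k ≤ n + 1) :
    ((initialWord X n).drop i).take k = factor X i k := by
  apply List.ext_getElem
  · simp [initialWord]; omega
  · intro j h₁ h₂
    simp [initialWord, factor]

variable [DecidableEq A]

/-- The indicator of an occurrence of `u` in `X` at position `i`. -/
def occ (u : List A) (i : ℕ) : ℝ := if factor X i u.length = u then 1 else 0

@[simp] lemma occ_nil (i : ℕ) : occ X [] i = 1 := by simp [occ]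

lemma occ_append_singleton (u : List A) (b : A) (i : ℕ) :
    occ X (u ++ [b]) i = occ X u i * if X (i + u.length) = b then 1 else 0 := by
  have : factor X i (u ++ [b]).length = u ++ [b] ↔
      factor X i u.length = u ∧ X (i + u.length) = b := by
    rw [List.length_append, List.length_singleton, factor_succ]
    refine ⟨fun h => ?_, fun h => by rw [h.1, h.2]⟩
    obtain ⟨h₁, h₂⟩ := List.append_inj h (length_factor X i _)
    exact ⟨h₁, List.singleton_inj.1 h₂⟩
  simp only [occ, this]
  split_ifs <;> simp_all

lemma nbocc_initialWord (u : List A) (n : ℕ) :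
    (nbocc u (initialWord X n) : ℝ) = ∑ i ∈ Finset.range (n + 2 - u.length), occ X u i := by
  simp only [occ, Finset.sum_boole, nbocc]
  congr 2
  ext i
  have hl : (initialWord X n).length = n + 1 := by simp [initialWord]
  simp only [Finset.mem_filter, Finset.mem_range, hl]
  constructor
  · rintro ⟨h₁, h₂, h₃⟩
    rw [take_drop_initialWord X h₂] at h₃
    exact ⟨by omega, h₃⟩
  · rintro ⟨h₁, h₂⟩
    exact ⟨by omega, by omega, by rw [take_drop_initialWord X (by omega), h₂]⟩

lemma freq_initialWord (u : List A) {n : ℕ} (h : u.length ≤ n + 1) :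
    freq u (initialWord X n) =
      (∑ i ∈ Finset.range (n + 2 - u.length), occ X u i) / ((n + 2 - u.length : ℕ) : ℝ) := by
  rw [freq, nbocc_initialWord, Nat.cast_sub (by omega)]
  congr 1
  simp [initialWord]
  ring

lemma tendsto_freq_iff (u : List A) (c : ℝ) :
    Tendsto (fun n => freq u (initialWord X n)) atTop (𝓝 c) ↔
      Tendsto (fun N : ℕ => (∑ i ∈ Finset.range N, occ X u i) / (N : ℝ)) atTop (𝓝 c) := by
  set f := fun N : ℕ => (∑ i ∈ Finset.range N, occ X u i) / (N : ℝ) with hf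
  have key : ∀ n, freq u (initialWord X (n + u.length)) = f (n + 2) := by
    intro n
    rw [freq_initialWord X u (by omega), hf]
    have : n + u.length + 2 - u.length = n + 2 := by omega
    simp only [this]
  rw [← tendsto_add_atTop_iff_nat u.length, ← tendsto_add_atTop_iff_nat (f := f) 2]
  simp only [key]

lemma isNormal_iff (μ : A → ℝ) :
    IsNormal μ X ↔ ∀ u : List A,
      Tendsto (fun N : ℕ => (∑ i ∈ Finset.range N, occ X u i) / (N : ℝ)) atTop
        (𝓝 (wordProb μ u)) :=
  forall_congr' fun u => tendsto_freq_iff X u _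

end Words

/-! ### Averages of matrix products along a normal sequence -/

section Matrices

variable {A S : Type*} [Fintype S] [DecidableEq S]

/-- The matrix of the word `w`. -/
def wordMatrix (M : A → Matrix S S ℝ) (w : List A) : Matrix S S ℝ := (w.map M).prod

lemma wordMatrix_cons (M : A → Matrix S S ℝ) (a : A) (w : List A) :
    wordMatrix M (a :: w) = M a * wordMatrix M w := by simp [wordMatrix]

/-- The prefix `u` makes the induction on `K` work: splitting on the first letter `a` of the window
pulls out the factor `M a` and turns `u` into `u ++ [a]`. -/
lemma IsNormal.tendsto_average_wordMatrix [Fintype A] [DecidableEq A] {μ : A → ℝ} {X : ℕ → A}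
    (hX : IsNormal μ X) (M : A → Matrix S S ℝ) (K : ℕ) (u : List A) :
    Tendsto (fun N : ℕ => (N : ℝ)⁻¹ • ∑ i ∈ Finset.range N,
        occ X u i • wordMatrix M (factor X (i + u.length) K)) atTop
      (𝓝 (wordProb μ u • (∑ a, μ a • M a) ^ K)) := by
  induction K generalizing u with
  | zero =>
    have := ((isNormal_iff X μ).1 hX u).smul_const (1 : Matrix S S ℝ)
    simpa [wordMatrix, Finset.sum_smul, div_eq_inv_mul, mul_smul] using this
  | succ K ih =>
    have h := tendsto_finsetSum Finset.univ fun a (_ : a ∈ Finset.univ) =>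
      (ih (u ++ [a])).const_mul (M a)
    convert h using 1
    · funext N
      simp only [mul_smul_comm, Finset.mul_sum, ← Finset.smul_sum]
      rw [Finset.sum_comm]
      congr 1
      refine Finset.sum_congr rfl fun i _ => ?_
      simp only [occ_append_singleton, List.length_append, List.length_singleton, factor_succ',
        wordMatrix_cons, mul_ite, mul_one, mul_zero, ite_smul, zero_smul, Finset.sum_ite_eq,
        Finset.mem_univ, if_true, add_assoc]
    · congr 1
      simp only [wordProb, List.map_append, List.prod_append, List.map_singleton,
        List.prod_singleton, mul_smul_comm, pow_succ', Finset.sum_mul, Finset.smul_sum,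
        smul_mul_assoc, mul_smul]

end Matrices

/-! ### Exponential decay of products of nonnegative matrices along a normal sequence -/

/-- A form of AM-GM, obtained by multiplying the tangent-line bounds x ≤ r exp(x/r - 1). -/
lemma prod_le_pow_of_sum_le {ι : Type*} {s : Finset ι} {F : ι → ℝ} (hF : ∀ i, 0 ≤ F i) {r : ℝ}
    (hr : 0 < r) (h : ∑ i ∈ s, F i ≤ r * s.card) : ∏ i ∈ s, F i ≤ r ^ s.card := by
  have h₁ : ∀ i, F i ≤ r * Real.exp (F i / r - 1) := fun i => by
    have := Real.add_one_le_exp (F i / r - 1)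
    rw [sub_add_cancel, div_le_iff₀' hr] at this
    exact this
  calc ∏ i ∈ s, F i ≤ ∏ i ∈ s, r * Real.exp (F i / r - 1) :=
        Finset.prod_le_prod (fun i _ => hF i) fun i _ => h₁ i
    _ = r ^ s.card * Real.exp ((∑ i ∈ s, F i) / r - s.card) := by
        rw [Finset.prod_mul_distrib, Finset.prod_const, ← Real.exp_sum, Finset.sum_sub_distrib,
          Finset.sum_div]
        simp
    _ ≤ r ^ s.card * 1 := by
        gcongr
        rw [Real.exp_le_one_iff, sub_nonpos, div_le_iff₀' hr]
        exact h
    _ = r ^ s.card := mul_one _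

lemma summable_of_average_lt_one {m F : ℕ → ℝ} (hm : ∀ n, 0 ≤ m n) (hF : ∀ n, 0 ≤ F n) {K : ℕ}
    (hK : K ≠ 0) (hmF : ∀ n, m (n + K) ≤ m n * F n) {B : ℝ} (hB : 1 ≤ B)
    (hmB : ∀ n, m (n + 1) ≤ B * m n) {c : ℝ} (hc : c < 1)
    (hFc : Tendsto (fun N : ℕ => (N : ℝ)⁻¹ * ∑ i ∈ Finset.range N, F i) atTop (𝓝 c)) :
    Summable m := by
  obtain ⟨r, hr, hr1⟩ := exists_between (max_lt hc one_pos)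
  have hr0 : 0 < r := (le_max_right _ _).trans_lt hr
  have hmB' : ∀ k n, m (n + k) ≤ B ^ k * m n := by
    intro k n
    induction k with
    | zero => simp
    | succ k ih =>
      calc m (n + k + 1) ≤ B * m (n + k) := hmB _
        _ ≤ B * (B ^ k * m n) := by gcongr
        _ = B ^ (k + 1) * m n := by ring
  -- `hmF` jumps `K` steps at once. The product of `K` consecutive values telescopes: moving the
  -- window by one replaces `m n` by `m (n + K)`, at the cost of a single factor `F n`.
  have hprod : ∀ n, ∏ s ∈ Finset.range K, m (n + s) ≤
      (∏ i ∈ Finset.range n, F i) * ∏ s ∈ Finset.range K, m s := by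
    intro n
    induction n with
    | zero => simp
    | succ n ih =>
      obtain ⟨k, rfl⟩ := Nat.exists_eq_succ_of_ne_zero hK
      have h₁ : ∏ s ∈ Finset.range (k + 1), m (n + 1 + s) =
          (∏ s ∈ Finset.range k, m (n + (s + 1))) * m (n + (k + 1)) := by
        rw [Finset.prod_range_succ]
        congr 1
        · exact Finset.prod_congr rfl fun s _ => by congr 1; omega
        · congr 1; omega
      have h₂ : ∏ s ∈ Finset.range (k + 1), m (n + s) =
          (∏ s ∈ Finset.range k, m (n + (s + 1))) * m n := Finset.prod_range_succ' _ _
      calc ∏ s ∈ Finset.range (k + 1), m (n + 1 + s)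
          ≤ (∏ s ∈ Finset.range k, m (n + (s + 1))) * (m n * F n) := by
            rw [h₁]
            exact mul_le_mul_of_nonneg_left (hmF n) (Finset.prod_nonneg fun _ _ => hm _)
        _ = (∏ s ∈ Finset.range (k + 1), m (n + s)) * F n := by rw [h₂]; ring
        _ ≤ ((∏ i ∈ Finset.range n, F i) * ∏ s ∈ Finset.range (k + 1), m s) * F n :=
            mul_le_mul_of_nonneg_right ih (hF n)
        _ = _ := by rw [Finset.prod_range_succ F]; ring
  have hev : ∀ᶠ n : ℕ in atTop, ∏ i ∈ Finset.range n, F i ≤ r ^ n := by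
    filter_upwards [hFc.eventually_le_const ((le_max_left _ _).trans_lt hr),
      eventually_gt_atTop 0] with n hn hn0
    have := prod_le_pow_of_sum_le (s := Finset.range n) hF hr0
    rw [Finset.card_range] at this
    apply this
    rwa [inv_mul_le_iff₀' (by exact_mod_cast hn0)] at hn
  -- The growth bound `B` compares `m (n + K)` with each of the `K` preceding values, at a cost of
  -- at most `B ^ K` each.
  set D := B ^ (K * K) * ∏ s ∈ Finset.range K, m s with hD
  have hD0 : 0 ≤ D := mul_nonneg (by positivity) (Finset.prod_nonneg fun _ _ => hm _)
  have hbound : ∀ᶠ n : ℕ in atTop, m (n + K) ^ K ≤ D * r ^ n := by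
    filter_upwards [hev] with n hn
    calc m (n + K) ^ K = ∏ s ∈ Finset.range K, m (n + K) := by simp
      _ ≤ ∏ s ∈ Finset.range K, B ^ K * m (n + s) := by
          refine Finset.prod_le_prod (fun _ _ => hm _) fun s hs => ?_
          have hs' := Finset.mem_range.1 hs
          calc m (n + K) = m (n + s + (K - s)) := by congr 1; omega
            _ ≤ B ^ (K - s) * m (n + s) := hmB' _ _
            _ ≤ B ^ K * m (n + s) :=
              mul_le_mul_of_nonneg_right (pow_le_pow_right₀ hB (Nat.sub_le _ _)) (hm _)
      _ = B ^ (K * K) * ∏ s ∈ Finset.range K, m (n + s) := by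
          rw [Finset.prod_mul_distrib, Finset.prod_const, Finset.card_range, pow_mul]
      _ ≤ B ^ (K * K) * (r ^ n * ∏ s ∈ Finset.range K, m s) := by
          gcongr
          exact (hprod n).trans
            (mul_le_mul_of_nonneg_right hn (Finset.prod_nonneg fun _ _ => hm _))
      _ = D * r ^ n := by rw [hD]; ring
  set s := r ^ ((K : ℝ)⁻¹) with hs
  set d := D ^ ((K : ℝ)⁻¹) with hd
  have hs0 : 0 ≤ s := Real.rpow_nonneg hr0.le _
  have hd0 : 0 ≤ d := Real.rpow_nonneg hD0 _
  have hsK : s ^ K = r := Real.rpow_inv_natCast_pow hr0.le hK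
  have hdK : d ^ K = D := Real.rpow_inv_natCast_pow hD0 hK
  have hs1 : s < 1 := by
    rw [← pow_lt_one_iff_of_nonneg hs0 hK, hsK]
    exact hr1
  rw [← summable_nat_add_iff K]
  refine Summable.of_norm_bounded_eventually_nat
    ((summable_geometric_of_lt_one hs0 hs1).mul_left d) ?_
  filter_upwards [hbound] with n hn
  rw [Real.norm_of_nonneg (hm _)]
  refine (pow_le_pow_iff_left₀ (hm _) (by positivity) hK).1 ?_
  rwa [mul_pow, hdK, ← pow_mul, mul_comm n K, pow_mul, hsK]

section Matrices

lemma sum_vecMul_le {S : Type*} [Fintype S] {p : S → ℝ} (hp : ∀ q, 0 ≤ p q)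
    {M : Matrix S S ℝ} (hM : ∀ q q', 0 ≤ M q q') :
    ∑ q', (Matrix.vecMul p M) q' ≤ (∑ q, p q) * ∑ q, ∑ q', M q q' := by
  simp only [Matrix.vecMul, dotProduct]
  rw [Finset.sum_comm, Finset.sum_mul]
  refine Finset.sum_le_sum fun q _ => ?_
  rw [← Finset.mul_sum]
  exact mul_le_mul_of_nonneg_left (Finset.single_le_sum (f := fun q => ∑ q', M q q')
    (fun r _ => Finset.sum_nonneg fun r' _ => hM r r') (Finset.mem_univ q)) (hp q)

variable {A S : Type*} [Fintype S] [DecidableEq S]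

lemma wordMatrix_nonneg {M : A → Matrix S S ℝ} (hM : ∀ a q q', 0 ≤ M a q q') (w : List A)
    (q q' : S) : 0 ≤ wordMatrix M w q q' := by
  induction w generalizing q with
  | nil => simp only [wordMatrix, List.map_nil, List.prod_nil, Matrix.one_apply]; positivity
  | cons a w ih =>
    rw [wordMatrix_cons, Matrix.mul_apply]
    exact Finset.sum_nonneg fun r _ => mul_nonneg (hM _ _ _) (ih _)

/-- The row sums of `P ^ (K * k)` are at most ρ ^ k for a uniform ρ < 1, which beats the number of
rows. The total over all entries is what `sum_vecMul_le` requires. -/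
lemma exists_total_pow_lt_one {P : Matrix S S ℝ} (hP : ∀ q q', 0 ≤ P q q') {K : ℕ}
    (hK : K ≠ 0) (h : ∀ q, ∑ q', (P ^ K) q q' < 1) :
    ∃ K' : ℕ, K' ≠ 0 ∧ ∑ q, ∑ q', (P ^ K') q q' < 1 := by
  obtain ⟨ρ, hρ0, hρ1, hρ⟩ : ∃ ρ : ℝ, 0 ≤ ρ ∧ ρ < 1 ∧ ∀ q, ∑ q', (P ^ K) q q' ≤ ρ := by
    cases isEmpty_or_nonempty S with
    | inl _ => exact ⟨0, le_rfl, one_pos, fun q => isEmptyElim q⟩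
    | inr _ =>
      obtain ⟨q₀, hq₀⟩ := Finite.exists_max fun q => ∑ q', (P ^ K) q q'
      exact ⟨max 0 (∑ q', (P ^ K) q₀ q'), le_max_left _ _, max_lt one_pos (h q₀),
        fun q => (hq₀ q).trans (le_max_right _ _)⟩
  have hPK : ∀ k q q', 0 ≤ (P ^ k) q q' := by
    intro k
    induction k with
    | zero => intro q q'; simp only [pow_zero, Matrix.one_apply]; positivity
    | succ k ih =>
      intro q q'
      rw [pow_succ, Matrix.mul_apply]
      exact Finset.sum_nonneg fun r _ => mul_nonneg (ih _ _) (hP _ _)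
  have hpow : ∀ k q, ∑ q', (P ^ (K * k)) q q' ≤ ρ ^ k := by
    intro k
    induction k with
    | zero => intro q; simp [Matrix.one_apply]
    | succ k ih =>
      intro q
      calc ∑ q', (P ^ (K * (k + 1))) q q'
          = ∑ r, (P ^ K) q r * ∑ q', (P ^ (K * k)) r q' := by
            rw [mul_add, mul_one, add_comm, pow_add]
            simp only [Matrix.mul_apply, Finset.mul_sum]
            rw [Finset.sum_comm]
        _ ≤ ∑ r, (P ^ K) q r * ρ ^ k :=
            Finset.sum_le_sum fun r _ => mul_le_mul_of_nonneg_left (ih r) (hPK K q r)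
        _ ≤ ρ * ρ ^ k := by
            rw [← Finset.sum_mul]
            exact mul_le_mul_of_nonneg_right (hρ q) (by positivity)
        _ = ρ ^ (k + 1) := by ring
  have hlim : Tendsto (fun k : ℕ => (Fintype.card S : ℝ) * ρ ^ k) atTop (𝓝 0) := by
    simpa using (tendsto_pow_atTop_nhds_zero_of_lt_one hρ0 hρ1).const_mul (Fintype.card S : ℝ)
  obtain ⟨k, hk, hk0⟩ := ((hlim.eventually_lt_const one_pos).and (eventually_ne_atTop 0)).exists
  refine ⟨K * k, mul_ne_zero hK hk0, lt_of_le_of_lt ?_ hk⟩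
  calc ∑ q, ∑ q', (P ^ (K * k)) q q' ≤ ∑ _q : S, ρ ^ k := Finset.sum_le_sum fun q _ => hpow k q
    _ = _ := by simp

lemma IsNormal.summable_vecMul [Fintype A] [DecidableEq A] {μ : A → ℝ} (hμ : ∀ a, 0 ≤ μ a)
    {X : ℕ → A} (hX : IsNormal μ X) {M : A → Matrix S S ℝ} (hM : ∀ a q q', 0 ≤ M a q q') {K : ℕ}
    (hK : K ≠ 0) (h : ∀ q, ∑ q', ((∑ a, μ a • M a) ^ K) q q' < 1) {p : ℕ → S → ℝ}
    (hp : ∀ n q, 0 ≤ p n q) (hpM : ∀ n, p (n + 1) = Matrix.vecMul (p n) (M (X n))) :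
    Summable fun n => ∑ q, p n q := by
  obtain ⟨L, hL, hLt⟩ := exists_total_pow_lt_one (P := ∑ a, μ a • M a)
    (fun q q' => by
      simp only [Matrix.sum_apply, Matrix.smul_apply, smul_eq_mul]
      exact Finset.sum_nonneg fun a _ => mul_nonneg (hμ a) (hM a q q')) hK h
  have hpow : ∀ k n, p (n + k) = Matrix.vecMul (p n) (wordMatrix M (factor X n k)) := by
    intro k
    induction k with
    | zero => intro n; simp [wordMatrix]
    | succ k ih =>
      intro n
      rw [factor_succ', wordMatrix_cons, ← Matrix.vecMul_vecMul, ← hpM, ← ih]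
      congr 1
      omega
  have htot : ∀ a, 0 ≤ ∑ q, ∑ q', M a q q' := fun a =>
    Finset.sum_nonneg fun q _ => Finset.sum_nonneg fun q' _ => hM a q q'
  refine summable_of_average_lt_one (K := L)
    (F := fun n => ∑ q, ∑ q', wordMatrix M (factor X n L) q q')
    (B := 1 + ∑ a, ∑ q, ∑ q', M a q q')
    (fun n => Finset.sum_nonneg fun q _ => hp n q)
    (fun n => Finset.sum_nonneg fun q _ => Finset.sum_nonneg fun q' _ =>
      wordMatrix_nonneg hM _ q q') hL (fun n => ?_)
    (le_add_of_nonneg_right (Finset.sum_nonneg fun a _ => htot a)) (fun n => ?_) hLt ?_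
  · rw [hpow L n]
    exact sum_vecMul_le (hp n) (wordMatrix_nonneg hM _)
  · rw [hpM n, mul_comm]
    refine (sum_vecMul_le (hp n) (hM _)).trans ?_
    refine mul_le_mul_of_nonneg_left ?_ (Finset.sum_nonneg fun q _ => hp n q)
    exact (Finset.single_le_sum (f := fun a => ∑ q, ∑ q', M a q q') (fun a _ => htot a)
      (Finset.mem_univ (X n))).trans (le_add_of_nonneg_left zero_le_one)
  -- With the empty prefix every position counts, so this is the plain average over all windows of
  -- length `L`.
  · have h₁ := hX.tendsto_average_wordMatrix M L []
    have h₂ := tendsto_finsetSum (Finset.univ : Finset S) fun q _ =>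
      tendsto_finsetSum (Finset.univ : Finset S) fun q' _ =>
        (tendsto_pi_nhds.1 (tendsto_pi_nhds.1 h₁ q) q')
    simp only [occ_nil, one_smul, List.length_nil, add_zero, wordProb, List.map_nil,
      List.prod_nil, Matrix.smul_apply, Matrix.sum_apply, smul_eq_mul] at h₂
    convert h₂ using 1
    · funext N
      simp only [← Finset.mul_sum]
      congr 1
      rw [Finset.sum_comm]
      exact Finset.sum_congr rfl fun q _ => Finset.sum_comm
    · simp only [one_mul]

end Matrices

/-! ### Mean square roots of the capital -/

namespace ProbGambler

variable {A Q : Type*} [Fintype A] {μ : A → ℝ}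

/-- The expected square root of the multiplier of a transition of `G` reading `a`, split according
to the source and target states. -/
def weight (G : ProbGambler μ Q) (a : A) : Matrix Q Q ℝ :=
  fun q q' => √(G.bet q a) * (G.trans q a q').toReal

lemma weight_nonneg (G : ProbGambler μ Q) (a : A) (q q' : Q) : 0 ≤ G.weight a q q' := by
  unfold weight; positivity

/-- The average of `weight` over a `μ`-random letter. -/
def meanWeight (G : ProbGambler μ Q) : Matrix Q Q ℝ := ∑ a, μ a • G.weight a

lemma meanWeight_apply (G : ProbGambler μ Q) (q q' : Q) :
    G.meanWeight q q' = ∑ a, μ a * G.weight a q q' := by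
  simp [meanWeight, Matrix.sum_apply]

lemma meanWeight_nonneg (G : ProbGambler μ Q) (hμ : ∀ a, 0 < μ a) (q q' : Q) :
    0 ≤ G.meanWeight q q' := by
  rw [meanWeight_apply]
  exact Finset.sum_nonneg fun a _ => mul_nonneg (hμ a).le (G.weight_nonneg a q q')

lemma sqrt_le_half_one_add {x : ℝ} (hx : 0 ≤ x) : √x ≤ (1 + x) / 2 := by
  nlinarith [sq_nonneg (√x - 1), Real.sq_sqrt hx]

lemma sum_half_one_add_bet (G : ProbGambler μ Q) (hμ_sum : ∑ a, μ a = 1) (q : Q) :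
    ∑ a, μ a * ((1 + G.bet q a) / 2) = 1 := by
  have : ∀ a, μ a * ((1 + G.bet q a) / 2) = (μ a + μ a * G.bet q a) / 2 := fun a => by ring
  simp only [this]
  rw [← Finset.sum_div, Finset.sum_add_distrib, hμ_sum, G.fair]
  norm_num

variable [Fintype Q]

lemma sum_weight (G : ProbGambler μ Q) (a : A) (q : Q) :
    ∑ q', G.weight a q q' = √(G.bet q a) := by
  have h : ∑ q', G.trans q a q' = 1 := by
    rw [← (G.trans q a).tsum_coe, tsum_fintype]
  simp only [weight]
  rw [← Finset.mul_sum, ← ENNReal.toReal_sum fun q' _ => (G.trans q a).apply_ne_top q', h,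
    ENNReal.toReal_one, mul_one]

lemma sum_meanWeight (G : ProbGambler μ Q) (q : Q) :
    ∑ q', G.meanWeight q q' = ∑ a, μ a * √(G.bet q a) := by
  simp only [meanWeight_apply]
  rw [Finset.sum_comm]
  simp only [← Finset.mul_sum, sum_weight]

lemma sum_meanWeight_le_one (G : ProbGambler μ Q) (hμ : ∀ a, 0 < μ a) (hμ_sum : ∑ a, μ a = 1)
    (q : Q) : ∑ q', G.meanWeight q q' ≤ 1 := by
  rw [sum_meanWeight, ← G.sum_half_one_add_bet hμ_sum q]
  exact Finset.sum_le_sum fun a _ =>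
    mul_le_mul_of_nonneg_left (sqrt_le_half_one_add (G.bet_nonneg q a)) (hμ a).le

/-- Equality in a sum of termwise inequalities with positive weights forces equality in √x ≤ (1 +
x)/2 for each letter. -/
lemma bet_eq_one_of_sum_meanWeight (G : ProbGambler μ Q) (hμ : ∀ a, 0 < μ a)
    (hμ_sum : ∑ a, μ a = 1) {q : Q} (hq : ∑ q', G.meanWeight q q' = 1) (a : A) :
    G.bet q a = 1 := by
  rw [sum_meanWeight, ← G.sum_half_one_add_bet hμ_sum q,
    Finset.sum_eq_sum_iff_of_le fun a _ =>
      mul_le_mul_of_nonneg_left (sqrt_le_half_one_add (G.bet_nonneg q a)) (hμ a).le] at hq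
  have h := mul_left_cancel₀ (hμ a).ne' (hq a (Finset.mem_univ a))
  have h₁ : √(G.bet q a) = 1 := by
    nlinarith [sq_nonneg (√(G.bet q a) - 1), Real.sq_sqrt (G.bet_nonneg q a)]
  simpa using h₁

variable [DecidableEq Q]

/-- The mean square root of the capital of `G`, started in state `q`, after reading a `μ`-random
word of length `k`. -/
def meanSqrt (G : ProbGambler μ Q) (k : ℕ) (q : Q) : ℝ := ∑ q', (G.meanWeight ^ k) q q'

@[simp] lemma meanSqrt_zero (G : ProbGambler μ Q) (q : Q) : G.meanSqrt 0 q = 1 := by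
  simp [meanSqrt, Matrix.one_apply]

lemma meanSqrt_succ (G : ProbGambler μ Q) (k : ℕ) (q : Q) :
    G.meanSqrt (k + 1) q = ∑ r, G.meanWeight q r * G.meanSqrt k r := by
  simp only [meanSqrt, pow_succ', Matrix.mul_apply, Finset.mul_sum]
  exact Finset.sum_comm

lemma meanSqrt_one (G : ProbGambler μ Q) (q : Q) : G.meanSqrt 1 q = ∑ r, G.meanWeight q r := by
  simp [meanSqrt]

lemma antitone_meanSqrt (G : ProbGambler μ Q) (hμ : ∀ a, 0 < μ a) (hμ_sum : ∑ a, μ a = 1)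
    (q : Q) : Antitone fun k => G.meanSqrt k q := by
  refine antitone_nat_of_succ_le fun k => ?_
  induction k generalizing q with
  | zero =>
    rw [zero_add, meanSqrt_one, meanSqrt_zero]
    exact G.sum_meanWeight_le_one hμ hμ_sum q
  | succ k ih =>
    rw [meanSqrt_succ G (k + 1), meanSqrt_succ G k]
    exact Finset.sum_le_sum fun r _ =>
      mul_le_mul_of_nonneg_left (ih r) (G.meanWeight_nonneg hμ q r)

lemma meanSqrt_le_one (G : ProbGambler μ Q) (hμ : ∀ a, 0 < μ a) (hμ_sum : ∑ a, μ a = 1)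
    (k : ℕ) (q : Q) : G.meanSqrt k q ≤ 1 := by
  simpa using G.antitone_meanSqrt hμ hμ_sum q (Nat.zero_le k)

/-- The states from which `G` never bets again. -/
def idle (G : ProbGambler μ Q) : Set Q := {q | ∀ k, G.meanSqrt k q = 1}

lemma bet_of_mem_idle (G : ProbGambler μ Q) (hμ : ∀ a, 0 < μ a) (hμ_sum : ∑ a, μ a = 1) {q : Q}
    (hq : q ∈ G.idle) (a : A) : G.bet q a = 1 :=
  G.bet_eq_one_of_sum_meanWeight hμ hμ_sum (by rw [← meanSqrt_one]; exact hq 1) a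

/-- For idle `q`, the value 1 of `meanSqrt (k + 1) q` is an average of the values `meanSqrt k r ≤ 1`
with weights summing to 1, so each value of positive weight is 1. -/
lemma mem_idle_of_trans_ne_zero (G : ProbGambler μ Q) (hμ : ∀ a, 0 < μ a)
    (hμ_sum : ∑ a, μ a = 1) {q q' : Q} (hq : q ∈ G.idle) {a : A} (h : G.trans q a q' ≠ 0) :
    q' ∈ G.idle := by
  intro k
  have hpos : 0 < G.meanWeight q q' := by
    rw [meanWeight_apply]
    refine Finset.sum_pos' (fun b _ => mul_nonneg (hμ b).le (G.weight_nonneg b q q'))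
      ⟨a, Finset.mem_univ a, mul_pos (hμ a) ?_⟩
    rw [weight, G.bet_of_mem_idle hμ hμ_sum hq, Real.sqrt_one, one_mul]
    exact ENNReal.toReal_pos h ((G.trans q a).apply_ne_top q')
  have h₁ : ∑ r, G.meanWeight q r * G.meanSqrt k r = ∑ r, G.meanWeight q r := by
    rw [← meanSqrt_succ, hq (k + 1), ← meanSqrt_one, hq 1]
  rw [Finset.sum_eq_sum_iff_of_le fun r _ => mul_le_of_le_one_right
    (G.meanWeight_nonneg hμ q r) (G.meanSqrt_le_one hμ hμ_sum k r)] at h₁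
  exact (mul_eq_left₀ hpos.ne').1 (h₁ q' (Finset.mem_univ q'))

lemma exists_meanSqrt_lt_one (G : ProbGambler μ Q) (hμ : ∀ a, 0 < μ a) (hμ_sum : ∑ a, μ a = 1) :
    ∃ K : ℕ, K ≠ 0 ∧ ∀ q ∉ G.idle, G.meanSqrt K q < 1 := by
  have h : ∀ q, ∃ k, q ∉ G.idle → G.meanSqrt k q < 1 := fun q => by
    by_cases hq : q ∈ G.idle
    · exact ⟨0, fun h => (h hq).elim⟩
    · obtain ⟨k, hk⟩ := not_forall.1 hq
      exact ⟨k, fun _ => lt_of_le_of_ne (G.meanSqrt_le_one hμ hμ_sum k q) hk⟩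
  choose k hk using h
  -- By antitonicity any common upper bound of the `k q` works; the added 1 makes it nonzero.
  refine ⟨∑ q, k q + 1, Nat.succ_ne_zero _, fun q hq => lt_of_le_of_lt ?_ (hk q hq)⟩
  exact G.antitone_meanSqrt hμ hμ_sum q
    ((Finset.single_le_sum (fun _ _ => Nat.zero_le _) (Finset.mem_univ q)).trans (Nat.le_succ _))

/-- The weights between states that are not idle. -/
def activeWeight (G : ProbGambler μ Q) (a : A) : Matrix {q // q ∉ G.idle} {q // q ∉ G.idle} ℝ :=
  (G.weight a).submatrix Subtype.val Subtype.val

-- Restricting to non-idle states discards the nonnegative contributions of paths through idle ones.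
open scoped Classical in
lemma sum_pow_activeWeight_le (G : ProbGambler μ Q) (hμ : ∀ a, 0 < μ a) (K : ℕ)
    (q : {q // q ∉ G.idle}) :
    ∑ q', ((∑ a, μ a • G.activeWeight a) ^ K) q q' ≤ G.meanSqrt K q := by
  have hP : ∀ r r' : {q // q ∉ G.idle},
      (∑ a, μ a • G.activeWeight a) r r' = G.meanWeight r r' := fun r r' => by
    simp [meanWeight, activeWeight, Matrix.sum_apply]
  have hnn : ∀ k r, 0 ≤ G.meanSqrt k r := by
    intro k
    induction k with
    | zero => simp
    | succ k ih =>
      intro r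
      rw [meanSqrt_succ]
      exact Finset.sum_nonneg fun r' _ => mul_nonneg (G.meanWeight_nonneg hμ r r') (ih r')
  induction K generalizing q with
  | zero => simp [Matrix.one_apply]
  | succ K ih =>
    rw [meanSqrt_succ, pow_succ']
    simp only [Matrix.mul_apply]
    rw [Finset.sum_comm]
    simp only [← Finset.mul_sum, hP]
    calc ∑ r : {q // q ∉ G.idle}, G.meanWeight q r *
          ∑ q', ((∑ a, μ a • G.activeWeight a) ^ K) r q'
        ≤ ∑ r : {q // q ∉ G.idle}, G.meanWeight q r * G.meanSqrt K r :=
          Finset.sum_le_sum fun r _ =>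
            mul_le_mul_of_nonneg_left (ih r) (G.meanWeight_nonneg hμ _ _)
      _ ≤ ∑ r, G.meanWeight q r * G.meanSqrt K r := by
          rw [← Fintype.sum_subtype_add_sum_subtype (· ∉ G.idle)
            fun r => G.meanWeight (q : Q) r * G.meanSqrt K r]
          exact le_add_of_nonneg_right (Finset.sum_nonneg fun r _ =>
            mul_nonneg (G.meanWeight_nonneg hμ _ _) (hnn K r))

/-- The mean square roots of the capital of `G` on `X`, split according to the current state. -/
def sqrtMass (G : ProbGambler μ Q) (X : ℕ → A) : ℕ → Q → ℝ
  | 0 => Pi.single G.start 1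
  | n + 1 => Matrix.vecMul (G.sqrtMass X n) (G.weight (X n))

lemma sqrtMass_nonneg (G : ProbGambler μ Q) (X : ℕ → A) (n : ℕ) (q : Q) :
    0 ≤ G.sqrtMass X n q := by
  induction n generalizing q with
  | zero =>
    rw [sqrtMass, Pi.single_apply]
    positivity
  | succ n ih => exact Finset.sum_nonneg fun r _ => mul_nonneg (ih r) (G.weight_nonneg _ _ _)

open scoped Classical in
lemma summable_sqrtMass_active [DecidableEq A] (G : ProbGambler μ Q) (hμ : ∀ a, 0 < μ a)
    (hμ_sum : ∑ a, μ a = 1) {X : ℕ → A} (hX : IsNormal μ X) :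
    Summable fun n => ∑ q : {q // q ∉ G.idle}, G.sqrtMass X n q := by
  obtain ⟨K, hK, hKlt⟩ := G.exists_meanSqrt_lt_one hμ hμ_sum
  refine hX.summable_vecMul (fun a => (hμ a).le) (M := G.activeWeight)
    (fun a q q' => G.weight_nonneg a q q') hK
    (fun q => (G.sum_pow_activeWeight_le hμ K q).trans_lt (hKlt q q.2))
    (p := fun n q => G.sqrtMass X n q) (fun n q => G.sqrtMass_nonneg X n q) fun n => ?_
  funext q'
  simp only [sqrtMass, Matrix.vecMul, dotProduct, activeWeight, Matrix.submatrix_apply]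
  -- No mass returns from idle states, so the non-idle part of `sqrtMass` obeys its own linear
  -- recursion.
  rw [← Fintype.sum_subtype_add_sum_subtype (· ∉ G.idle)
    fun r => G.sqrtMass X n r * G.weight (X n) r q']
  refine add_eq_left.2 (Finset.sum_eq_zero fun r _ => ?_)
  have : G.trans r (X n) q' = 0 := by
    by_contra h
    exact q'.2 (G.mem_idle_of_trans_ne_zero hμ hμ_sum (not_not.1 r.2) h)
  simp [weight, this]

end ProbGambler

/-! ### The law of the run -/

/-- Such a function factors through the restriction to `s`, which takes values in a finite discrete
space. -/
lemma measurable_of_dependsOn_finset {ι Q β : Type*} [Finite Q] [MeasurableSpace Q]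
    [DiscreteMeasurableSpace Q] [MeasurableSpace β] [Nonempty β] {s : Finset ι} {f : (ι → Q) → β}
    (hf : DependsOn f (s : Set ι)) : Measurable f := by
  obtain ⟨φ, rfl⟩ := dependsOn_iff_exists_comp.1 hf
  exact (measurable_of_finite φ).comp (Set.measurable_restrict _)

lemma lintegral_mul_eval_infinitePi {ι Q : Type*} [Finite Q] [MeasurableSpace Q]
    [DiscreteMeasurableSpace Q] (ν : ι → Measure Q) [∀ i, IsProbabilityMeasure (ν i)]
    (s : Finset ι) {i : ι} (hi : i ∉ s) {f : (ι → Q) → ℝ≥0∞} (hf : DependsOn f (s : Set ι))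
    (g : Q → ℝ≥0∞) :
    ∫⁻ t, f t * g (t i) ∂Measure.infinitePi ν =
      (∫⁻ t, f t ∂Measure.infinitePi ν) * ∫⁻ x, g x ∂ν i := by
  have hfm := measurable_of_dependsOn_finset hf
  obtain ⟨φ, rfl⟩ := dependsOn_iff_exists_comp.1 hf
  have hind : iIndepFun (fun (i : ι) (t : ι → Q) => t i) (Measure.infinitePi ν) :=
    iIndepFun_infinitePi (X := fun _ x => x) fun _ => measurable_id
  have h₁ := hind.indepFun_finset s {i} (by simpa using hi) fun j => measurable_pi_apply j
  have hgm : Measurable g := measurable_of_finite g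
  have h₂ := h₁.comp (φ := φ) (ψ := fun x : ({i} : Finset ι) → Q => g (x ⟨i, by simp⟩))
    (measurable_of_finite φ)
    (hgm.comp (measurable_pi_apply _))
  rw [← (measurePreserving_eval_infinitePi ν i).lintegral_comp hgm]
  exact lintegral_mul_eq_lintegral_mul_lintegral_of_indepFun'' hfm.aemeasurable
    (hgm.comp (measurable_pi_apply i)).aemeasurable h₂

lemma ProbAutomaton.dependsOn_state {Q A : Type*} (M : ProbAutomaton Q A) (X : ℕ → A) (n : ℕ) :
    DependsOn (fun t => M.state X t n) {i : ℕ × Q × A | i.1 ≤ n} := by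
  intro t t' h
  induction n with
  | zero => rfl
  | succ n ih =>
    have ih' := ih fun i hi => h i (Nat.le_succ_of_le hi)
    simp only [ProbAutomaton.state] at ih' ⊢
    rw [ih']
    exact h _ (by simp)

lemma ProbGambler.dependsOn_capital {Q A : Type*} [Fintype A] {μ : A → ℝ} (G : ProbGambler μ Q)
    (X : ℕ → A) (n : ℕ) :
    DependsOn (fun t => G.capital X t n) {i : ℕ × Q × A | i.1 ≤ n} := by
  intro t t' h
  induction n with
  | zero => rfl
  | succ n ih =>
    have h' : ∀ i : ℕ × Q × A, i ∈ {i : ℕ × Q × A | i.1 ≤ n} → t i = t' i :=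
      fun i hi => h i (Nat.le_succ_of_le hi)
    have h₁ := ih h'
    have h₂ := G.toProbAutomaton.dependsOn_state X n h'
    simp only [ProbGambler.capital] at h₁ h₂ ⊢
    rw [h₁, h₂]

lemma ProbGambler.capital_nonneg {Q A : Type*} [Fintype A] {μ : A → ℝ} (G : ProbGambler μ Q)
    (X : ℕ → A) (t : ℕ × Q × A → Q) (n : ℕ) : 0 ≤ G.capital X t n := by
  induction n with
  | zero => exact zero_le_one
  | succ n ih => exact mul_nonneg ih (G.bet_nonneg _ _)

namespace ProbGambler

variable {A Q : Type*} [Fintype A] {μ : A → ℝ}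

lemma ae_trans_ne_zero [Finite Q] [MeasurableSpace Q]
    [DiscreteMeasurableSpace Q] (G : ProbGambler μ Q) :
    ∀ᵐ t ∂G.transitionLaw, ∀ i : ℕ × Q × A, G.trans i.2.1 i.2.2 (t i) ≠ 0 := by
  rw [ae_all_iff]
  intro i
  have h : ∀ᵐ x ∂(G.trans i.2.1 i.2.2).toMeasure, G.trans i.2.1 i.2.2 x ≠ 0 := by
    rw [ae_iff, PMF.toMeasure_apply_eq_zero_iff _ MeasurableSet.of_discrete]
    rw [Set.disjoint_left]
    intro x hx
    simpa using hx
  exact (measurePreserving_eval_infinitePi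
    (fun i : ℕ × Q × A => (G.trans i.2.1 i.2.2).toMeasure) i).quasiMeasurePreserving.ae h

section Law

variable [Fintype Q] [DecidableEq Q]

/-- The square root of the capital on the event that the current state is `q`. -/
def sqrtCapitalAt (G : ProbGambler μ Q) (X : ℕ → A) (n : ℕ) (q : Q) (t : ℕ × Q × A → Q) : ℝ≥0∞ :=
  if G.state X t n = q then ENNReal.ofReal √(G.capital X t n) else 0

lemma dependsOn_sqrtCapitalAt (G : ProbGambler μ Q) (X : ℕ → A) (n : ℕ) (q : Q) :
    DependsOn (G.sqrtCapitalAt X n q)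
      ((Finset.Iic n ×ˢ Finset.univ : Finset (ℕ × Q × A)) : Set (ℕ × Q × A)) := by
  intro t t' h
  have h' : ∀ i : ℕ × Q × A, i ∈ {i : ℕ × Q × A | i.1 ≤ n} → t i = t' i :=
    fun i hi => h i (by simpa using hi)
  have h₁ := G.dependsOn_capital X n h'
  have h₂ := G.toProbAutomaton.dependsOn_state X n h'
  simp only at h₁ h₂
  simp only [sqrtCapitalAt, h₁, h₂]

/-- Summing over all possible current states gives the next transition a non-random index `(n + 1,
q, X n)`, so that independence applies to it. -/
lemma sqrtCapitalAt_succ (G : ProbGambler μ Q) (X : ℕ → A) (n : ℕ) (q' : Q)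
    (t : ℕ × Q × A → Q) :
    G.sqrtCapitalAt X (n + 1) q' t = ∑ q, ENNReal.ofReal √(G.bet q (X n)) *
      (G.sqrtCapitalAt X n q t * if t (n + 1, q, X n) = q' then 1 else 0) := by
  rw [Finset.sum_eq_single (G.state X t n)]
  · simp only [sqrtCapitalAt, ProbAutomaton.state, capital, if_true, mul_ite, mul_one, mul_zero,
      Real.sqrt_mul (G.capital_nonneg X t n), ENNReal.ofReal_mul (Real.sqrt_nonneg _)]
    rw [mul_comm]
  · intro q _ hq
    simp [sqrtCapitalAt, hq.symm]
  · simp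

variable [MeasurableSpace Q] [DiscreteMeasurableSpace Q]

lemma measurable_sqrtCapitalAt (G : ProbGambler μ Q) (X : ℕ → A) (n : ℕ) (q : Q) :
    Measurable (G.sqrtCapitalAt X n q) :=
  measurable_of_dependsOn_finset (G.dependsOn_sqrtCapitalAt X n q)

lemma lintegral_sqrtCapitalAt (G : ProbGambler μ Q) (X : ℕ → A) (n : ℕ) (q : Q) :
    ∫⁻ t, G.sqrtCapitalAt X n q t ∂G.transitionLaw = ENNReal.ofReal (G.sqrtMass X n q) := by
  have hprob : IsProbabilityMeasure G.transitionLaw := by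
    unfold ProbAutomaton.transitionLaw; infer_instance
  induction n generalizing q with
  | zero =>
    simp only [sqrtCapitalAt, ProbAutomaton.state, capital, sqrtMass, Pi.single_apply]
    by_cases h : G.start = q
    · simp [h]
    · simp [h, Ne.symm h]
  | succ n ih =>
    have hm : ∀ r, Measurable fun t : ℕ × Q × A → Q =>
        G.sqrtCapitalAt X n r t * if t (n + 1, r, X n) = q then 1 else 0 := fun r =>
      (G.measurable_sqrtCapitalAt X n r).mul
        ((measurable_of_finite fun x : Q => if x = q then (1 : ℝ≥0∞) else 0).comp
          (measurable_pi_apply _))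
    simp only [sqrtCapitalAt_succ]
    rw [lintegral_finsetSum _ fun r _ => (hm r).const_mul _, sqrtMass, Matrix.vecMul, dotProduct,
      ENNReal.ofReal_sum_of_nonneg fun r _ =>
        mul_nonneg (G.sqrtMass_nonneg X n r) (G.weight_nonneg _ _ _)]
    refine Finset.sum_congr rfl fun r _ => ?_
    rw [lintegral_const_mul _ (hm r)]
    -- The past involves only transitions of index at most `n`; the coordinate of index `n + 1` is
    -- fresh.
    have h := lintegral_mul_eval_infinitePi
      (fun i : ℕ × Q × A => (G.trans i.2.1 i.2.2).toMeasure) _ (i := (n + 1, r, X n)) (by simp)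
      (G.dependsOn_sqrtCapitalAt X n r) fun x => if x = q then 1 else 0
    have hq : ∫⁻ x, (if x = q then (1 : ℝ≥0∞) else 0) ∂(G.trans r (X n)).toMeasure =
        G.trans r (X n) q := by
      rw [← PMF.toMeasure_apply_singleton _ q (MeasurableSet.of_discrete),
        ← lintegral_indicator_one (MeasurableSet.of_discrete)]
      refine lintegral_congr fun x => ?_
      simp [Set.indicator_apply]
    rw [ProbAutomaton.transitionLaw, h, hq]
    rw [ProbAutomaton.transitionLaw] at ih
    rw [ih, weight, ENNReal.ofReal_mul (G.sqrtMass_nonneg X n r),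
      ENNReal.ofReal_mul (Real.sqrt_nonneg _), ENNReal.ofReal_toReal (PMF.apply_ne_top _ _)]
    ring

open scoped Classical in
lemma ae_tsum_sqrtCapitalAt_lt_top [DecidableEq A] (G : ProbGambler μ Q) (hμ : ∀ a, 0 < μ a)
    (hμ_sum : ∑ a, μ a = 1) {X : ℕ → A} (hX : IsNormal μ X) :
    ∀ᵐ t ∂G.transitionLaw, ∑' n, ∑ q : {q // q ∉ G.idle}, G.sqrtCapitalAt X n q t < ∞ := by
  have hm : ∀ n, Measurable fun t =>
      ∑ q : {q // q ∉ G.idle}, G.sqrtCapitalAt X n q t := fun n =>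
    Finset.measurable_fun_sum _ fun q _ => G.measurable_sqrtCapitalAt X n q
  refine ae_lt_top (Measurable.tsum hm) ?_
  rw [lintegral_tsum fun n => (hm n).aemeasurable]
  have : ∀ n, ∫⁻ t, ∑ q : {q // q ∉ G.idle}, G.sqrtCapitalAt X n q t ∂G.transitionLaw =
      ENNReal.ofReal (∑ q : {q // q ∉ G.idle}, G.sqrtMass X n q) := fun n => by
    rw [lintegral_finsetSum _ fun (q : {q // q ∉ G.idle}) _ =>
        G.measurable_sqrtCapitalAt X n (q : Q),
      ENNReal.ofReal_sum_of_nonneg fun (q : {q // q ∉ G.idle}) _ => G.sqrtMass_nonneg X n q]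
    simp only [lintegral_sqrtCapitalAt]
  simp only [this]
  exact (G.summable_sqrtMass_active hμ hμ_sum hX).tsum_ofReal_ne_top

end Law

lemma not_wins_iff (G : ProbGambler μ Q) (X : ℕ → A) (t : ℕ × Q × A → Q) :
    ¬ G.Wins X t ↔ ∃ B : ℝ, ∀ᶠ n in atTop, G.capital X t n ≤ B := by
  constructor
  · intro h
    obtain ⟨B, hB, -⟩ := EReal.lt_iff_exists_real_btwn.1 (lt_top_iff_ne_top.2 h)
    refine ⟨B, (eventually_lt_of_limsup_lt hB).mono fun n hn => ?_⟩
    exact_mod_cast hn.le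
  · rintro ⟨B, hB⟩ h
    have : limsup (fun n => ((G.capital X t n : ℝ) : EReal)) atTop ≤ (B : EReal) :=
      limsup_le_of_le (by isBoundedDefault) (hB.mono fun n hn => by exact_mod_cast hn)
    rw [Wins] at h
    rw [h] at this
    exact absurd this (not_le.2 (EReal.coe_lt_top B))

open scoped Classical in
theorem losesAlmostSurely_of_isNormal [DecidableEq A] [Finite Q] (G : ProbGambler μ Q)
    (hμ : ∀ a, 0 < μ a) (hμ_sum : ∑ a, μ a = 1) {X : ℕ → A} (hX : IsNormal μ X) :
    G.LosesAlmostSurely X := by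
  have := Fintype.ofFinite Q
  let _ : MeasurableSpace Q := ⊤
  change ∀ᵐ t ∂G.transitionLaw, ¬ G.Wins X t
  filter_upwards [G.ae_tsum_sqrtCapitalAt_lt_top hμ hμ_sum hX, G.ae_trans_ne_zero] with t h₁ h₂
  rw [not_wins_iff]
  by_cases h : ∃ n, G.state X t n ∈ G.idle
  · obtain ⟨n₀, hn₀⟩ := h
    have hconst : ∀ n ≥ n₀, G.state X t n ∈ G.idle ∧ G.capital X t n = G.capital X t n₀ := by
      intro n hn
      induction n, hn using Nat.le_induction with
      | base => exact ⟨hn₀, rfl⟩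
      | succ n _ ih =>
        refine ⟨G.mem_idle_of_trans_ne_zero hμ hμ_sum ih.1 (h₂ (n + 1, G.state X t n, X n)), ?_⟩
        rw [capital, G.bet_of_mem_idle hμ hμ_sum ih.1, mul_one, ih.2]
    exact ⟨G.capital X t n₀, (eventually_ge_atTop n₀).mono fun n hn => (hconst n hn).2.le⟩
  -- The square root of the capital is then, at every time, one term of a summable series, hence
  -- eventually at most 1.
  · push Not at h
    have hlim := ENNReal.tendsto_atTop_zero_of_tsum_ne_top h₁.ne
    refine ⟨1, (hlim.eventually_le_const one_pos).mono fun n hn => ?_⟩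
    have hle : G.sqrtCapitalAt X n (G.state X t n) t ≤ 1 :=
      (Finset.single_le_sum (f := fun q : {q // q ∉ G.idle} => G.sqrtCapitalAt X n q t)
        (fun _ _ => zero_le) (Finset.mem_univ ⟨_, h n⟩)).trans hn
    rw [sqrtCapitalAt, if_pos rfl, ENNReal.ofReal_le_one, Real.sqrt_le_one] at hle
    exact hle

end ProbGambler

/-! ### Gamblers that bet on the letter following a given word -/

section FollowingWord

variable {A : Type*} [Fintype A] [DecidableEq A] {μ : A → ℝ}

/-- The window of the last `k` letters read, after one more letter `a`. -/
def shiftWindow {A : Type*} {k : ℕ} (v : Fin k → Option A) (a : A) : Fin k → Option A :=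
  fun i => if h : (i : ℕ) + 1 < k then v ⟨i + 1, h⟩ else some a

lemma abs_indicator_sub_le_one (hμ : ∀ a, 0 < μ a) (hμ_sum : ∑ a, μ a = 1) (a b : A) :
    |(if a = b then 1 else 0) - μ b| ≤ 1 := by
  have h : μ b ≤ 1 := hμ_sum ▸ Finset.single_le_sum (fun a _ => (hμ a).le) (Finset.mem_univ b)
  have := hμ b
  rw [abs_le]
  split_ifs <;> constructor <;> linarith

/-- The deterministic gambler that remembers the last `|u|` letters read, encoded by `e`, and after
each occurrence of `u` bets on the letter `b` if `0 ≤ ε`, and against it otherwise. -/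
def followingWordGambler (hμ : ∀ a, 0 < μ a) (hμ_sum : ∑ a, μ a = 1) {Q : Type*} (u : List A)
    (e : Q ≃ (Fin u.length → Option A)) (b : A) {ε : ℝ} (hε : |ε| ≤ 1 / 2) : ProbGambler μ Q where
  start := e.symm fun _ => none
  trans q a := PMF.pure (e.symm (shiftWindow (e q) a))
  bet q a := if ∀ i, e q i = some (u.get i) then 1 + ε * ((if a = b then 1 else 0) - μ b) else 1
  bet_nonneg q a := by
    split
    · have h : |ε * ((if a = b then 1 else 0) - μ b)| ≤ 1 / 2 * 1 := by
        rw [abs_mul]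
        exact mul_le_mul hε (abs_indicator_sub_le_one hμ hμ_sum a b) (abs_nonneg _) (by norm_num)
      linarith [(abs_le.1 h).1]
    · exact zero_le_one
  fair q := by
    split
    · have : ∀ a, μ a * (1 + ε * ((if a = b then 1 else 0) - μ b)) =
          μ a + ε * ((if a = b then μ a else 0) - μ a * μ b) := fun a => by
        split_ifs <;> ring
      simp only [this]
      rw [Finset.sum_add_distrib, ← Finset.mul_sum, Finset.sum_sub_distrib, ← Finset.sum_mul,
        hμ_sum]
      simp
    · simpa using hμ_sum

variable (hμ : ∀ a, 0 < μ a) (hμ_sum : ∑ a, μ a = 1) {Q : Type*} (u : List A)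
  (e : Q ≃ (Fin u.length → Option A)) (b : A) {ε : ℝ} (hε : |ε| ≤ 1 / 2) (X : ℕ → A)

lemma state_followingWordGambler (n : ℕ) :
    e ((followingWordGambler hμ hμ_sum u e b hε).state X
      (fun i => e.symm (shiftWindow (e i.2.1) i.2.2)) n) =
      fun i : Fin u.length =>
        if u.length ≤ n + i then some (X (n + i - u.length)) else none := by
  induction n with
  | zero =>
    funext i
    simp [ProbAutomaton.state, followingWordGambler, i.2]
  | succ n ih =>
    funext i
    simp only [ProbAutomaton.state, Equiv.apply_symm_apply, shiftWindow, ih]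
    have hi := i.2
    by_cases h : (i : ℕ) + 1 < u.length
    · have h₁ : n + (i + 1) = n + 1 + i := by omega
      simp only [h, dite_true, h₁]
    · have h₁ : u.length ≤ n + 1 + i := by omega
      have h₂ : n + 1 + i - u.length = n := by omega
      simp only [h, dite_false, h₁, if_true, h₂]

lemma bet_followingWordGambler (n : ℕ) :
    (followingWordGambler hμ hμ_sum u e b hε).bet
      ((followingWordGambler hμ hμ_sum u e b hε).state X
        (fun i => e.symm (shiftWindow (e i.2.1) i.2.2)) n) (X n) =
      if u.length ≤ n then
        1 + ε * (occ X (u ++ [b]) (n - u.length) - μ b * occ X u (n - u.length))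
      else 1 := by
  have h := state_followingWordGambler hμ hμ_sum u e b hε X n
  change (if ∀ i, e _ i = some (u.get i) then 1 + ε * ((if X n = b then 1 else 0) - μ b)
    else 1) = _
  simp only [h]
  by_cases hn : u.length ≤ n
  · have h₁ : ∀ i : Fin u.length, u.length ≤ n + i := fun i => by omega
    have h₂ : (∀ i : Fin u.length, some (X (n + i - u.length)) = some (u.get i)) ↔
        factor X (n - u.length) u.length = u := by
      constructor
      · intro h
        refine List.ext_getElem (by simp) fun j h₁ h₂ => ?_
        have := Option.some.inj (h ⟨j, h₂⟩)
        simp only [List.get_eq_getElem] at this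
        rw [← this]
        simp only [factor, List.getElem_map, List.getElem_range]
        congr 1
        omega
      · intro h i
        have : (factor X (n - u.length) u.length)[(i : ℕ)]'(by simp) = u[i] := by
          simp only [h, Fin.getElem_fin]
        rw [List.get_eq_getElem, ← Fin.getElem_fin, ← this]
        simp only [factor, List.getElem_map, List.getElem_range]
        congr 2
        omega
    simp only [h₁, if_true, h₂, hn, occ_append_singleton, Nat.sub_add_cancel hn]
    unfold occ
    split_ifs <;> ring
  · have h₁ : ¬ ∀ i : Fin u.length,
        (if u.length ≤ n + i then some (X (n + i - u.length)) else none) = some (u.get i) := by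
      intro h
      -- Here `u` is nonempty and the oldest slot of the window still holds `none`, so no occurrence
      -- is detected too early.
      have := h ⟨0, by omega⟩
      simp [hn] at this
    rw [if_neg h₁, if_neg hn]

lemma capital_followingWordGambler (n : ℕ) :
    (followingWordGambler hμ hμ_sum u e b hε).capital X
        (fun i => e.symm (shiftWindow (e i.2.1) i.2.2)) (u.length + n) =
      ∏ i ∈ Finset.range n, (1 + ε * (occ X (u ++ [b]) i - μ b * occ X u i)) := by
  induction n with
  | zero =>
    have : ∀ n ≤ u.length, (followingWordGambler hμ hμ_sum u e b hε).capital X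
        (fun i => e.symm (shiftWindow (e i.2.1) i.2.2)) n = 1 := by
      intro n hn
      induction n with
      | zero => rfl
      | succ n ih =>
        rw [ProbGambler.capital, ih (by omega), bet_followingWordGambler, if_neg (by omega),
          one_mul]
    simpa using this _ le_rfl
  | succ n ih =>
    rw [← add_assoc, ProbGambler.capital, ih, bet_followingWordGambler, if_pos (by omega),
      Finset.prod_range_succ, Nat.add_sub_cancel_left]

/-- A product of point masses is a point mass, so losing almost surely means losing on this one
outcome. -/
lemma transitionLaw_followingWordGambler [Finite Q] [MeasurableSpace Q] :
    (followingWordGambler hμ hμ_sum u e b hε).transitionLaw =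
      Measure.dirac fun i => e.symm (shiftWindow (e i.2.1) i.2.2) := by
  rw [← Measure.infinitePi_dirac, ProbAutomaton.transitionLaw]
  congr 1
  funext i
  exact PMF.toMeasure_pure _

lemma exists_prod_le_of_losesAlmostSurely [Finite Q]
    (h : (followingWordGambler hμ hμ_sum u e b hε).LosesAlmostSurely X) :
    ∃ B : ℝ, ∀ᶠ n in atTop,
      ∏ i ∈ Finset.range n, (1 + ε * (occ X (u ++ [b]) i - μ b * occ X u i)) ≤ B := by
  let _ : MeasurableSpace Q := ⊤
  change ∀ᵐ t ∂(followingWordGambler hμ hμ_sum u e b hε).transitionLaw, _ at h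
  rw [transitionLaw_followingWordGambler, ae_dirac_eq, eventually_pure,
    ProbGambler.not_wins_iff] at h
  obtain ⟨B, hB⟩ := h
  refine ⟨B, ?_⟩
  have := (tendsto_add_atTop_nat u.length).eventually hB
  filter_upwards [this] with n hn
  rwa [add_comm n, capital_followingWordGambler] at hn

end FollowingWord

/-! ### Averages of bounded sequences of bets -/

/-- From 1 + y ≤ exp y at y = -(x - 2x²), because (1 - x + 2x²)(1 + x) = 1 + x²(1 + 2x) ≥ 1. -/
lemma exp_sub_two_mul_sq_le {x : ℝ} (hx : |x| ≤ 1 / 2) : Real.exp (x - 2 * x ^ 2) ≤ 1 + x := by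
  obtain ⟨h₁, h₂⟩ := abs_le.1 hx
  have h := Real.add_one_le_exp (-(x - 2 * x ^ 2))
  have hpos : 0 < 1 + x := by linarith
  have h₃ : 1 ≤ Real.exp (-(x - 2 * x ^ 2)) * (1 + x) := by
    refine le_trans ?_ (mul_le_mul_of_nonneg_right h hpos.le)
    nlinarith [mul_nonneg (sq_nonneg x) (by linarith : 0 ≤ 1 + 2 * x)]
  rw [Real.exp_neg, inv_mul_eq_div, le_div_iff₀ (Real.exp_pos _), one_mul] at h₃
  exact h₃

lemma eventually_mul_sum_le_of_prod_le {d : ℕ → ℝ} (hd : ∀ i, |d i| ≤ 1) {ε : ℝ}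
    (hε : |ε| ≤ 1 / 2) {B : ℝ}
    (h : ∀ᶠ n in atTop, ∏ i ∈ Finset.range n, (1 + ε * d i) ≤ B) :
    ∃ L : ℝ, ∀ᶠ n : ℕ in atTop, ε * ∑ i ∈ Finset.range n, d i ≤ 2 * ε ^ 2 * n + L := by
  refine ⟨Real.log B, h.mono fun n hn => ?_⟩
  have h₁ : Real.exp (ε * ∑ i ∈ Finset.range n, d i - 2 * ε ^ 2 * n) ≤
      ∏ i ∈ Finset.range n, (1 + ε * d i) := by
    calc Real.exp (ε * ∑ i ∈ Finset.range n, d i - 2 * ε ^ 2 * n)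
        = ∏ i ∈ Finset.range n, Real.exp (ε * d i - 2 * ε ^ 2) := by
          rw [← Real.exp_sum, Finset.sum_sub_distrib, ← Finset.mul_sum, Finset.sum_const,
            Finset.card_range, nsmul_eq_mul, mul_comm (n : ℝ)]
      _ ≤ _ := by
          refine Finset.prod_le_prod (fun _ _ => (Real.exp_pos _).le) fun i _ => ?_
          have hsq : d i ^ 2 ≤ 1 := (sq_le_one_iff_abs_le_one _).2 (hd i)
          refine le_trans (Real.exp_le_exp.2 ?_) (exp_sub_two_mul_sq_le (x := ε * d i) ?_)
          · rw [mul_pow]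
            nlinarith [mul_le_mul_of_nonneg_left hsq (sq_nonneg ε)]
          · rw [abs_mul, ← mul_one (1 / 2 : ℝ)]
            exact mul_le_mul hε (hd i) (abs_nonneg _) (by norm_num)
  have h₂ := (Real.le_log_iff_exp_le ((Real.exp_pos _).trans_le (h₁.trans hn))).2 (h₁.trans hn)
  linarith

/-- Taking logarithms for ε and -ε bounds the absolute average by 2ε + L/(εn), where ε is
arbitrarily small. -/
lemma tendsto_average_zero_of_prod_bounded {d : ℕ → ℝ} (hd : ∀ i, |d i| ≤ 1)
    (h : ∀ ε : ℝ, |ε| ≤ 1 / 2 →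
      ∃ B : ℝ, ∀ᶠ n in atTop, ∏ i ∈ Finset.range n, (1 + ε * d i) ≤ B) :
    Tendsto (fun n : ℕ => (∑ i ∈ Finset.range n, d i) / (n : ℝ)) atTop (𝓝 0) := by
  rw [Metric.tendsto_nhds]
  intro δ hδ
  -- ε ≤ δ/4 gives 2ε² ≤ εδ/2; the other half of εδn absorbs the constants `L₁` and `L₂`.
  set ε := min (1 / 2) (δ / 4) with hεdef
  have hε0 : 0 < ε := lt_min (by norm_num) (by positivity)
  have hεδ : ε ≤ δ / 4 := min_le_right _ _
  have hε2 : |ε| ≤ 1 / 2 := by rw [abs_of_pos hε0]; exact min_le_left _ _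
  obtain ⟨B₁, hB₁⟩ := h ε hε2
  obtain ⟨B₂, hB₂⟩ := h (-ε) (by rwa [abs_neg])
  obtain ⟨L₁, hL₁⟩ := eventually_mul_sum_le_of_prod_le hd hε2 hB₁
  obtain ⟨L₂, hL₂⟩ := eventually_mul_sum_le_of_prod_le hd (by rwa [abs_neg]) hB₂
  have hbig : Tendsto (fun n : ℕ => ε * (δ / 2) * (n : ℝ)) atTop atTop :=
    tendsto_natCast_atTop_atTop.const_mul_atTop (by positivity)
  filter_upwards [hL₁, hL₂, hbig.eventually_gt_atTop L₁, hbig.eventually_gt_atTop L₂,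
    eventually_gt_atTop 0] with n h₁ h₂ h₃ h₄ hn
  have hn' : (0 : ℝ) < n := by exact_mod_cast hn
  have h₅ : 2 * ε ^ 2 * (n : ℝ) ≤ ε * (δ / 2) * n := by
    refine mul_le_mul_of_nonneg_right ?_ hn'.le
    nlinarith
  rw [Real.dist_eq, sub_zero, abs_div, abs_of_pos hn', div_lt_iff₀ hn', abs_lt]
  constructor
  · refine lt_of_mul_lt_mul_left ?_ hε0.le
    rw [neg_sq] at h₂
    linarith
  · refine lt_of_mul_lt_mul_left ?_ hε0.le
    linarith

theorem isNormal_of_loses.{u, v} {A : Type u} [Fintype A] [DecidableEq A] {μ : A → ℝ}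
    (hμ : ∀ a, 0 < μ a) (hμ_sum : ∑ a, μ a = 1) {X : ℕ → A}
    (h : ∀ (Q : Type v) [Finite Q] (G : ProbGambler μ Q), G.LosesAlmostSurely X) :
    IsNormal μ X := by
  rw [isNormal_iff]
  intro u
  induction u using List.reverseRecOn with
  | nil =>
    refine tendsto_const_nhds.congr' ?_
    filter_upwards [eventually_gt_atTop 0] with n hn
    have : (n : ℝ) ≠ 0 := by exact_mod_cast hn.ne'
    simp [wordProb, this]
  | append_singleton u b ih =>
    have hd : ∀ i, |occ X (u ++ [b]) i - μ b * occ X u i| ≤ 1 := fun i => by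
      have := abs_indicator_sub_le_one hμ hμ_sum (X (i + u.length)) b
      rw [occ_append_singleton, mul_comm (μ b), ← mul_sub, abs_mul]
      refine mul_le_one₀ ?_ (abs_nonneg _) this
      unfold occ
      split_ifs <;> simp
    have h₁ := tendsto_average_zero_of_prod_bounded hd fun ε hε => by
      -- `Shrink` moves the finite window type into the universe `v` of the admitted state sets.
      have : Finite (Shrink.{v} (Fin u.length → Option A)) := Finite.of_equiv _ (equivShrink _)
      exact exists_prod_le_of_losesAlmostSurely hμ hμ_sum u
        (equivShrink.{v} (Fin u.length → Option A)).symm b hε X (h _ _)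
    have h₂ := h₁.add (ih.const_mul (μ b))
    convert h₂ using 1
    · funext n
      rw [Finset.sum_sub_distrib, ← Finset.mul_sum]
      ring
    · simp [wordProb, mul_comm]

end PFA

end

theorem mainTheorem2 {A : Type*} [Fintype A] [DecidableEq A] (μ : A → ℝ)
    (hμ_pos : ∀ a, 0 < μ a) (hμ_sum : ∑ a, μ a = 1) (X : ℕ → A) :
    PFA.IsNormal μ X ↔
      ∀ (Q : Type*) [Finite Q] (G : PFA.ProbGambler μ Q), G.LosesAlmostSurely X :=
  ⟨fun hX _ _ G => G.losesAlmostSurely_of_isNormal hμ_pos hμ_sum hX,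
    fun h => PFA.isNormal_of_loses hμ_pos hμ_sum h⟩
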